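/- Let $(\Omega,\mu)=\prod_{i=1}^n(\Omega_i,\mu_i)$ be a product of finitely many probability spaces, where each $\Omega_i$ is linearly ordered. Let $A_1,\dots,A_k\subseteq\Omega$ be arbitrary events (not necessarily increasing or decreasing). For $I\subseteq[k]$ say that the events $(A_j)_{j\in I}$ occur disjointly at $\omega\in\Omega$ if there are pairwise disjoint sets $S_j\subseteq[n]$ $(j\in I)$ such that, for each $j\in I$, every $\omega'\in\Omega$ that agrees with $\omega$ on $S_j$ belongs to $A_j$. Let $$X(\omega)=\max\{|I| : I\subseteq[k],\ (A_j)_{j\in I}\text{ occur disjointly at }\omega\},\qquad \lambda=\sum_{j=1}^k\Pr(A_j),$$ and $\varphi(x)=(1+x)\log(1+x)-x$. If $\lambda>0$, then for every real $t\ge 0$ $$\Pr(X\ge\lambda+t)\ \le\ \exp\left[-\lambda\,\varphi(t/\lambda)\right]\ \le\ \exp\left[-\frac{t^2}{2(\lambda+t/3)}\right].$$ If $\lambda=0$, then $\Pr(X\ge\lambda+t)=0$ for every $t>0$. (If the event $\{X\ge\lambda+t\}$ is not measurable, $\Pr$ of it denotes its outer probability.) -/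

import Mathlib

open MeasureTheory

/-- The set `S` of coordinates witnesses `ω ∈ A`: every `ω'` that agrees with `ω` on `S`
belongs to `A`. -/
def Witnesses {ι : Type*} {Ω : ι → Type*} (S : Finset ι) (ω : ∀ i, Ω i)
    (A : Set (∀ i, Ω i)) : Prop :=
  ∀ ω' : ∀ i, Ω i, (∀ i ∈ S, ω' i = ω i) → ω' ∈ A

/-- The event that the `A j` with `j ∈ I` occur disjointly: there are pairwise disjoint sets
`S j` of coordinates, one for each `j ∈ I`, such that `S j` witnesses `ω ∈ A j`.
(The values of `S` outside `I` play no role.) -/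
def disjointOccurrence {ι κ : Type*} {Ω : ι → Type*} (A : κ → Set (∀ i, Ω i))
    (I : Finset κ) : Set (∀ i, Ω i) :=
  {ω | ∃ S : κ → Finset ι,
    (∀ j ∈ I, ∀ l ∈ I, j ≠ l → Disjoint (S j) (S l)) ∧ ∀ j ∈ I, Witnesses (S j) ω (A j)}

open Classical in
/-- The maximum size of a set of indices whose events occur disjointly at `ω`
(the empty index set always qualifies). -/
noncomputable def maxDisjoint {ι κ : Type*} [Fintype κ] {Ω : ι → Type*}
    (A : κ → Set (∀ i, Ω i)) (ω : ∀ i, Ω i) : ℕ :=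
  (Finset.univ.filter fun I : Finset κ => ω ∈ disjointOccurrence A I).sup Finset.card

/-- `φ(x) = (1 + x) log (1 + x) - x`, used for `x ≥ -1`; since `Real.log 0 = 0`, the formula
also gives the conventional value `φ(-1) = 1`. -/
noncomputable def chernoffPhi (x : ℝ) : ℝ := (1 + x) * Real.log (1 + x) - x

/-! The events satisfy the van den Berg–Kesten–Reimer inequality: Pr(all A_j, j ∈ I, occur
disjointly) ≤ ∏_{j ∈ I} Pr(A_j). With c = t/λ, (1+c)^X is at most the sum of c^|J| over the J whose
events occur disjointly, so its mean is at most ∏(1 + c Pr(A_j)) ≤ e^{cλ}, and Markov's inequality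
gives the Chernoff bound.

For two events, BKR comes from Reimer's lemma on the cube (`card_le_card_inter_antipode`): draw two
independent values per coordinate and condition on the pairs; only the choice ε of which value goes
to which configuration remains, and negating ε swaps the configurations. Induction gives several
events.

Witness events need not be measurable, so `essWitness` replaces them by measurable supersets whose
union is no likelier than A_j. -/

/-! ### Reimer's lemma by linear algebra -/

open Finset in
/-- If an integer matrix indexed by a finite partial order is unitriangular modulo `2`, then its
rows are linearly independent over `ℝ`. -/
lemma eq_zero_of_unitriangular_mod_two {m : Type*} [Fintype m] [PartialOrder m]
    (M : m → m → ℤ) (hdiag : ∀ x, (M x x : ZMod 2) = 1)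
    (htri : ∀ x y, (M x y : ZMod 2) ≠ 0 → y ≤ x)
    (c : m → ℝ) (hc : ∀ y, ∑ x, c x * (M x y : ℝ) = 0) : c = 0 := by
  classical
  let A : Matrix m m ℤ := Matrix.of M
  have h2 : (A.map (Int.castRingHom (ZMod 2))).det ≠ 0 := by
    intro h0
    obtain ⟨v, hv, hv0⟩ := Matrix.exists_vecMul_eq_zero_iff.mpr h0
    -- At a maximal x of the support of v, triangularity leaves only the diagonal term in column x.
    obtain ⟨x, hx, hmax⟩ := (univ.filter fun x => v x ≠ 0).exists_maximal (by
      obtain ⟨x, hx⟩ := Function.ne_iff.mp hv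
      exact ⟨x, by simpa using hx⟩)
    have hx' : v x ≠ 0 := by simpa using hx
    have := congrFun hv0 x
    simp only [Matrix.vecMul, dotProduct, Matrix.map_apply, Pi.zero_apply] at this
    rw [Finset.sum_eq_single x] at this
    · simp [A, hdiag] at this
      exact hx' this
    · intro y _ hy
      by_contra hne
      have h1 := left_ne_zero_of_mul hne
      have h3 := htri y x (by simpa [A] using right_ne_zero_of_mul hne)
      exact hy (le_antisymm (hmax (by simpa using h1) h3) h3)
    · simp
  have hZ : A.det ≠ 0 := by
    intro h0
    apply h2
    rw [← RingHom.mapMatrix_apply, ← RingHom.map_det, h0, map_zero]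
  have hR : (A.map (Int.castRingHom ℝ)).det ≠ 0 := by
    rw [← RingHom.mapMatrix_apply, ← RingHom.map_det]
    simpa using hZ
  refine Matrix.eq_zero_of_vecMul_eq_zero hR ?_
  ext y
  simpa [Matrix.vecMul, dotProduct, A] using hc y

/-- One-coordinate factors of the vectors attached to a butterfly `(x, S)`; the flag `s` says
whether the coordinate lies in `S`. -/
def wingFactor (s x y : Bool) : ℤ :=
  if s then (if y = x then 1 else 0) else (if x = false ∧ y = true then 2 else 1)

/-- The image of `wingFactor s x` under the positive definite matrix `!![2, -1; -1, 1]`. -/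
def dualWingFactor (s x y : Bool) : ℤ :=
  if s then (if x = y then (if x then 1 else 2) else -1) else (if y = x then 0 else 1)

/-- The image of `wingFactor s x` under a square root of `!![2, -1; -1, 1]`. -/
def rootWingFactor (s x y : Bool) : ℤ :=
  if y then wingFactor s x false else wingFactor s x false - wingFactor s x true

/-- With M = !![2, -1; -1, 1] = BᵀB this is ⟨v, Mv'⟩ = ⟨Bv, Bv'⟩. The entry 2 in `wingFactor` makes
the dual vanish at y = x off S, yet disappears modulo 2. -/
lemma sum_wingFactor_mul_dual (s x s' x' : Bool) :
    ∑ y, wingFactor s x y * dualWingFactor s' x' y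
      = ∑ y, rootWingFactor s x y * rootWingFactor s' x' y := by
  revert s x s' x'; decide

/-- The coefficients are those of B⁻¹. -/
lemma wingFactor_eq_sum_root (s x y : Bool) :
    wingFactor s x y = ∑ z, (if z then 1 else if y then -1 else 0) * rootWingFactor s x z := by
  revert s x y; decide

open Finset in
/-- **Reimer's lemma**: the red wings `{y | y = x on S x}` and the antipodes of the yellow wings
`{y | y = x off S x}` of a flock of butterflies with bodies in `T` have at least `#T` common
points. -/
theorem card_le_card_inter_antipode {ι : Type*} [Fintype ι] [DecidableEq ι]
    (T R Y : Finset (ι → Bool)) (S : (ι → Bool) → Finset ι)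
    (hR : ∀ x ∈ T, ∀ y : ι → Bool, (∀ i ∈ S x, y i = x i) → y ∈ R)
    (hY : ∀ x ∈ T, ∀ y : ι → Bool, (∀ i ∉ S x, y i = x i) → y ∈ Y) :
    #T ≤ #{y ∈ R | (fun i => !y i) ∈ Y} := by
  let f : (ι → Bool) → (ι → Bool) → ℤ := fun x y => ∏ i, wingFactor (decide (i ∈ S x)) (x i) (y i)
  let g : (ι → Bool) → (ι → Bool) → ℤ :=
    fun x y => ∏ i, dualWingFactor (decide (i ∈ S x)) (x i) (y i)
  let u : (ι → Bool) → (ι → Bool) → ℤ :=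
    fun x y => ∏ i, rootWingFactor (decide (i ∈ S x)) (x i) (y i)
  have hfg : ∀ x x', ∑ y, f x y * g x' y = ∑ y, u x y * u x' y := by
    intro x x'
    simp only [f, g, u, ← Finset.prod_mul_distrib]
    rw [← Fintype.prod_sum fun i b => wingFactor (decide (i ∈ S x)) (x i) b *
        dualWingFactor (decide (i ∈ S x')) (x' i) b,
      ← Fintype.prod_sum fun i b => rootWingFactor (decide (i ∈ S x)) (x i) b *
        rootWingFactor (decide (i ∈ S x')) (x' i) b]
    exact Finset.prod_congr rfl fun i _ => sum_wingFactor_mul_dual _ _ _ _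
  have hfu : ∀ x y, f x y = ∑ z : ι → Bool,
      (∏ i, (if z i then 1 else if y i then -1 else 0)) * u x z := by
    intro x y
    simp only [f, u, ← Finset.prod_mul_distrib]
    rw [← Fintype.prod_sum fun i b => (if b then 1 else if y i then -1 else 0) *
        rootWingFactor (decide (i ∈ S x)) (x i) b]
    exact Finset.prod_congr rfl fun i _ => wingFactor_eq_sum_root _ _ _
  have hfR : ∀ x ∈ T, ∀ y, f x y ≠ 0 → y ∈ R := by
    intro x hx y h
    refine hR x hx y fun i hi => ?_
    have := Finset.prod_ne_zero_iff.mp h i (mem_univ i)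
    by_contra hne
    simp [wingFactor, hi, hne] at this
  have hgY : ∀ x ∈ T, ∀ y, g x y ≠ 0 → (fun i => !y i) ∈ Y := by
    intro x hx y h
    refine hY x hx _ fun i hi => ?_
    have := Finset.prod_ne_zero_iff.mp h i (mem_univ i)
    by_contra hne
    have hxy : y i = x i := by
      revert hne; cases y i <;> cases x i <;> simp
    simp [dualWingFactor, hi, hxy] at this
  have hind : ∀ c : (ι → Bool) → ℝ, (∀ y, ∑ x, c x * (f x y : ℝ) = 0) → c = 0 := by
    refine eq_zero_of_unitriangular_mod_two f ?_ ?_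
    · intro x
      simp only [f, Int.cast_prod]
      refine Finset.prod_eq_one fun i _ => ?_
      generalize decide (i ∈ S x) = s, x i = b
      revert s b; decide
    · intro x y h
      simp only [f, Int.cast_prod] at h
      intro i
      have := Finset.prod_ne_zero_iff.mp h i (mem_univ i)
      have key : ∀ s b d : Bool, ((wingFactor s b d : ℤ) : ZMod 2) ≠ 0 → d ≤ b := by decide
      exact key _ _ _ this
  set Q := {y ∈ R | (fun i => !y i) ∈ Y} with hQ
  -- Injectivity of this map gives #T ≤ #Q by comparing dimensions.
  let L : (T → ℝ) →ₗ[ℝ] (Q → ℝ) :=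
    { toFun := fun c y => ∑ x : T, c x * (f x y : ℝ)
      map_add' := by intro a b; ext y; simp [add_mul, Finset.sum_add_distrib]
      map_smul' := by intro a b; ext y; simp [mul_assoc, Finset.mul_sum] }
  have hL : Function.Injective L := by
    rw [← LinearMap.ker_eq_bot, LinearMap.ker_eq_bot']
    intro c hc
    let C : (ι → Bool) → ℝ := fun x => if h : x ∈ T then c ⟨x, h⟩ else 0
    have hC : ∀ w : (ι → Bool) → ℝ, ∑ x, C x * w x = ∑ x : T, c x * w x := by
      intro w
      rw [← Finset.sum_subset (Finset.subset_univ T) (by intro x _ hx; simp [C, hx]),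
        ← Finset.sum_coe_sort T]
      exact Finset.sum_congr rfl fun x _ => by simp [C]
    have hCT : ∀ x, C x ≠ 0 → x ∈ T := fun x h => by
      by_contra hx; exact h (by simp [C, hx])
    -- The squared norm of ∑ C u equals ⟨∑ C f, ∑ C g⟩. Each term vanishes: on Q since c is in the
    -- kernel, off R through f, off the antipode of Y through g.
    have hzero : ∑ y, (∑ x, C x * (u x y : ℝ)) * (∑ x, C x * (u x y : ℝ)) = 0 := by
      have h1 : ∑ y, (∑ x, C x * (u x y : ℝ)) * (∑ x, C x * (u x y : ℝ))
          = ∑ y, (∑ x, C x * (f x y : ℝ)) * (∑ x, C x * (g x y : ℝ)) := by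
        have hexp : ∀ a b : (ι → Bool) → (ι → Bool) → ℤ,
            ∑ y, (∑ x, C x * (a x y : ℝ)) * (∑ x, C x * (b x y : ℝ))
              = ∑ x, ∑ x', C x * C x' * ((∑ y, a x y * b x' y : ℤ) : ℝ) := by
          intro a b
          simp only [Finset.sum_mul_sum]
          rw [Finset.sum_comm]
          refine Finset.sum_congr rfl fun x _ => ?_
          rw [Finset.sum_comm]
          refine Finset.sum_congr rfl fun x' _ => ?_
          push_cast
          rw [Finset.mul_sum]
          exact Finset.sum_congr rfl fun y _ => by ring
        rw [hexp, hexp]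
        simp only [hfg]
      rw [h1]
      refine Finset.sum_eq_zero fun y _ => ?_
      by_cases hyR : y ∈ R
      · by_cases hyY : (fun i => !y i) ∈ Y
        · have := congrFun hc ⟨y, by simp [hQ, hyR, hyY]⟩
          rw [hC (fun x => (f x y : ℝ))]
          have h3 : ∑ x : T, c x * (f x y : ℝ) = 0 := this
          rw [h3, zero_mul]
        · refine mul_eq_zero_of_right _ (Finset.sum_eq_zero fun x _ => ?_)
          by_contra h
          refine hyY (hgY x (hCT x (left_ne_zero_of_mul h)) y ?_)
          exact_mod_cast right_ne_zero_of_mul h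
      · refine mul_eq_zero_of_left (Finset.sum_eq_zero fun x _ => ?_) _
        by_contra h
        refine hyR (hfR x (hCT x (left_ne_zero_of_mul h)) y ?_)
        exact_mod_cast right_ne_zero_of_mul h
    have hu0 : ∀ y, ∑ x, C x * (u x y : ℝ) = 0 := by
      intro y
      have := (Finset.sum_eq_zero_iff_of_nonneg (fun y _ => mul_self_nonneg _)).mp hzero y
        (mem_univ y)
      exact mul_self_eq_zero.mp this
    have hC0 : C = 0 := by
      refine hind C fun y => ?_
      simp only [hfu, Int.cast_sum, Int.cast_mul, Finset.mul_sum]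
      rw [Finset.sum_comm]
      refine Finset.sum_eq_zero fun z _ => ?_
      rw [← mul_zero (((∏ i, (if z i then 1 else if y i then -1 else 0) : ℤ)) : ℝ), ← hu0 z,
        Finset.mul_sum]
      exact Finset.sum_congr rfl fun x _ => by ring
    ext x
    have := congrFun hC0 x
    simpa [C] using this
  simpa using LinearMap.finrank_le_finrank_of_injective hL

/-! ### The BKR inequality on product spaces -/

section BKR

variable {ι : Type*} [Fintype ι] {Ω : ι → Type*} [∀ i, MeasurableSpace (Ω i)]

/-- The two configurations read off from a family of pairs, `ε i` telling which entry of the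
`i`-th pair goes to the second configuration. -/
def splitPairs (ε : ι → Bool) (w : ∀ i, Ω i × Ω i) : (∀ i, Ω i) × (∀ i, Ω i) :=
  (fun i => if ε i then (w i).2 else (w i).1, fun i => if ε i then (w i).1 else (w i).2)

lemma measurable_splitPairs (ε : ι → Bool) : Measurable (splitPairs (Ω := Ω) ε) := by
  refine Measurable.prodMk (measurable_pi_lambda _ fun i => ?_) (measurable_pi_lambda _ fun i => ?_)
  · cases ε i <;> simp <;> fun_prop
  · cases ε i <;> simp <;> fun_prop

variable (μ : ∀ i, Measure (Ω i)) [∀ i, IsProbabilityMeasure (μ i)]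

/-- Swapping two independent entries of equal law changes nothing; it suffices to check rectangles.
-/
lemma measurePreserving_splitPairs (ε : ι → Bool) :
    MeasurePreserving (splitPairs ε) (Measure.pi fun i => (μ i).prod (μ i))
      ((Measure.pi μ).prod (Measure.pi μ)) := by
  refine ⟨measurable_splitPairs ε, Eq.symm ?_⟩
  let span : (Measure.pi μ).FiniteSpanningSetsIn
      (Set.pi Set.univ '' Set.pi Set.univ fun i => {s : Set (Ω i) | MeasurableSet s}) :=
    ⟨fun _ => Set.univ, fun _ => ⟨fun _ => Set.univ, by simp, by simp⟩, fun _ => by simp,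
      Set.iUnion_const _⟩
  refine Measure.prod_eq_generateFrom generateFrom_pi generateFrom_pi isPiSystem_pi isPiSystem_pi
    span span ?_
  rintro _ ⟨s, hs, rfl⟩ _ ⟨t, ht, rfl⟩
  have hs' : ∀ i, MeasurableSet (s i) := fun i => hs i trivial
  have ht' : ∀ i, MeasurableSet (t i) := fun i => ht i trivial
  rw [Measure.map_apply (measurable_splitPairs ε)
    ((MeasurableSet.univ_pi hs').prod (MeasurableSet.univ_pi ht'))]
  have : splitPairs ε ⁻¹' (Set.univ.pi s ×ˢ Set.univ.pi t)
      = Set.univ.pi fun i => if ε i then t i ×ˢ s i else s i ×ˢ t i := by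
    ext w
    simp only [splitPairs, Set.mem_preimage, Set.mem_prod, Set.mem_pi, Set.mem_univ,
      forall_true_left, ← forall_and]
    refine forall_congr' fun i => ?_
    cases ε i <;> simp [and_comm]
  rw [this, Measure.pi_pi, Measure.pi_pi, Measure.pi_pi, ← Finset.prod_mul_distrib]
  refine Finset.prod_congr rfl fun i _ => ?_
  cases ε i <;> simp [Measure.prod_prod, mul_comm]

open Finset Classical in
/-- For fixed pairs, Reimer's lemma bounds the number of ways to choose a configuration in which
two witnessed events occur disjointly. -/
lemma card_splitPairs_le {C D : Finset ι → Set (∀ i, Ω i)}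
    (hC : ∀ S ω ω', (∀ i ∈ S, ω' i = ω i) → ω ∈ C S → ω' ∈ C S)
    (hD : ∀ S ω ω', (∀ i ∈ S, ω' i = ω i) → ω ∈ D S → ω' ∈ D S) (w : ∀ i, Ω i × Ω i) :
    #{ε : ι → Bool | (splitPairs ε w).1 ∈ {ω | ∃ S T, Disjoint S T ∧ ω ∈ C S ∧ ω ∈ D T}}
      ≤ #{ε : ι → Bool | splitPairs ε w ∈ (⋃ S, C S) ×ˢ (⋃ S, D S)} := by
  let P : (ι → Bool) → Finset ι → Prop := fun ε S =>
    ∃ T, Disjoint S T ∧ (splitPairs ε w).1 ∈ C S ∧ (splitPairs ε w).1 ∈ D T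
  let S : (ι → Bool) → Finset ι := fun ε => if h : ∃ S, P ε S then h.choose else ∅
  have hS : ∀ ε, (∃ S, P ε S) → P ε (S ε) := fun ε h => by
    simp only [S, dif_pos h]; exact h.choose_spec
  refine (card_le_card_inter_antipode _ {ε | (splitPairs ε w).1 ∈ ⋃ S, C S}
    {ε | (splitPairs ε w).1 ∈ ⋃ S, D S} S ?_ ?_).trans (card_le_card ?_)
  · intro ε hε ε' h
    obtain ⟨T, -, h1, -⟩ := hS ε (by simpa using hε)
    simp only [mem_filter, mem_univ, true_and]
    refine Set.mem_iUnion.mpr ⟨S ε, hC _ _ _ (fun i hi => ?_) h1⟩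
    simp [splitPairs, h i hi]
  · intro ε hε ε' h
    obtain ⟨T, hd, -, h2⟩ := hS ε (by simpa using hε)
    simp only [mem_filter, mem_univ, true_and]
    refine Set.mem_iUnion.mpr ⟨T, hD _ _ _ (fun i hi => ?_) h2⟩
    simp [splitPairs, h i (Finset.disjoint_right.mp hd hi)]
  · intro ε
    simp only [mem_filter, mem_univ, true_and, Set.mem_prod]
    rintro ⟨h1, h2⟩
    refine ⟨h1, ?_⟩
    -- The second configuration for ε is the first one for its antipode.
    convert h2 using 2
    ext i
    cases h : ε i <;> simp [splitPairs, h]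

open Finset Classical in
/-- **The van den Berg–Kesten–Reimer inequality** on a product of arbitrary probability spaces,
for events presented as unions of measurable cylinders. -/
theorem measure_disjoint_occurrence_le {C D : Finset ι → Set (∀ i, Ω i)}
    (hCm : ∀ S, MeasurableSet (C S)) (hDm : ∀ S, MeasurableSet (D S))
    (hC : ∀ S ω ω', (∀ i ∈ S, ω' i = ω i) → ω ∈ C S → ω' ∈ C S)
    (hD : ∀ S ω ω', (∀ i ∈ S, ω' i = ω i) → ω ∈ D S → ω' ∈ D S) :
    Measure.pi μ {ω | ∃ S T, Disjoint S T ∧ ω ∈ C S ∧ ω ∈ D T}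
      ≤ Measure.pi μ (⋃ S, C S) * Measure.pi μ (⋃ S, D S) := by
  set E := {ω | ∃ S T, Disjoint S T ∧ ω ∈ C S ∧ ω ∈ D T} with hE
  have hEm : MeasurableSet E := by
    have : E = ⋃ S, ⋃ T, ⋃ _ : Disjoint S T, C S ∩ D T := by
      ext; simp [hE, and_left_comm]
    rw [this]
    exact .iUnion fun S => .iUnion fun T => .iUnion fun _ => (hCm S).inter (hDm T)
  have hFm : MeasurableSet ((⋃ S, C S) ×ˢ (⋃ S, D S)) :=
    (MeasurableSet.iUnion hCm).prod (.iUnion hDm)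
  set ν := Measure.pi fun i => (μ i).prod (μ i)
  have hsum : ∀ G : Set ((∀ i, Ω i) × (∀ i, Ω i)), MeasurableSet G →
      Fintype.card (ι → Bool) * ((Measure.pi μ).prod (Measure.pi μ)) G
        = ∫⁻ w, (#{ε : ι → Bool | splitPairs ε w ∈ G} : ENNReal) ∂ν := by
    intro G hG
    have h1 : ∀ w, (#{ε : ι → Bool | splitPairs ε w ∈ G} : ENNReal)
        = ∑ ε : ι → Bool, (splitPairs ε ⁻¹' G).indicator 1 w := by
      intro w
      simp [Set.indicator_apply, Finset.sum_boole]
    simp only [h1]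
    rw [lintegral_finsetSum _ fun ε _ =>
      measurable_one.indicator (measurable_splitPairs ε hG)]
    have h2 : ∀ ε : ι → Bool, ν (splitPairs ε ⁻¹' G)
        = ((Measure.pi μ).prod (Measure.pi μ)) G := fun ε =>
      (measurePreserving_splitPairs μ ε).measure_preimage hG.nullMeasurableSet
    simp only [lintegral_indicator_one (measurable_splitPairs _ hG), h2]
    simp
  have key : (Fintype.card (ι → Bool) : ENNReal) * Measure.pi μ E
      ≤ Fintype.card (ι → Bool) * (Measure.pi μ (⋃ S, C S) * Measure.pi μ (⋃ S, D S)) := by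
    have h1 : Measure.pi μ E = ((Measure.pi μ).prod (Measure.pi μ)) (E ×ˢ Set.univ) := by simp
    rw [h1, ← Measure.prod_prod, hsum _ (hEm.prod .univ), hsum _ hFm]
    refine lintegral_mono fun w => Nat.cast_le.mpr ?_
    simpa [hE] using card_splitPairs_le hC hD w
  exact (ENNReal.mul_le_mul_iff_right (by simp) (by simp)).mp key

/-- Iterated version of the van den Berg–Kesten–Reimer inequality. -/
theorem measure_disjoint_occurrence_le_prod {κ : Type*} {C : κ → Finset ι → Set (∀ i, Ω i)}
    (hCm : ∀ j S, MeasurableSet (C j S))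
    (hC : ∀ j S ω ω', (∀ i ∈ S, ω' i = ω i) → ω ∈ C j S → ω' ∈ C j S) (I : Finset κ) :
    Measure.pi μ {ω | ∃ S : κ → Finset ι, (∀ j ∈ I, ∀ l ∈ I, j ≠ l → Disjoint (S j) (S l)) ∧
        ∀ j ∈ I, ω ∈ C j (S j)}
      ≤ ∏ j ∈ I, Measure.pi μ (⋃ S, C j S) := by
  classical
  induction I using Finset.induction_on with
  | empty => simp
  | insert a I ha ih =>
    -- Disjoint occurrence of the remaining events, with all witnesses inside U, is itself a
    -- cylinder event over U, so the two-event inequality applies.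
    let D : Finset ι → Set (∀ i, Ω i) := fun U =>
      {ω | ∃ S : I → Finset ι, ((∀ j l, j ≠ l → Disjoint (S j) (S l)) ∧ ∀ j, S j ⊆ U) ∧
        ∀ j : I, ω ∈ C j (S j)}
    have hDm : ∀ U, MeasurableSet (D U) := by
      intro U
      have : D U = ⋃ S : I → Finset ι, ⋃ _ : (∀ j l, j ≠ l → Disjoint (S j) (S l)) ∧
          ∀ j, S j ⊆ U, ⋂ j : I, C j (S j) := by ext; simp [D]
      rw [this]
      exact .iUnion fun S => .iUnion fun _ => .iInter fun j => hCm _ _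
    have hD : ∀ S ω ω', (∀ i ∈ S, ω' i = ω i) → ω ∈ D S → ω' ∈ D S := by
      rintro U ω ω' h ⟨S, ⟨hd, hU⟩, hS⟩
      exact ⟨S, ⟨hd, hU⟩, fun j => hC _ _ _ _ (fun i hi => h i (hU j hi)) (hS j)⟩
    rw [Finset.prod_insert ha]
    refine (measure_mono ?_).trans
      ((measure_disjoint_occurrence_le μ (hCm a) hDm (hC a) hD).trans ?_)
    · rintro ω ⟨S, hd, hS⟩
      refine ⟨S a, I.biUnion S, ?_, hS a (by simp), fun j => S j, ⟨?_, ?_⟩, ?_⟩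
      · rw [Finset.disjoint_biUnion_right]
        intro j hj
        exact hd a (by simp) j (by simp [hj]) (by rintro rfl; exact ha hj)
      · intro j l hjl
        exact hd j (by simp) l (by simp) (fun h => hjl (Subtype.ext h))
      · intro j
        exact Finset.subset_biUnion_of_mem S j.2
      · intro j
        exact hS j (by simp)
    · gcongr
      refine (measure_mono ?_).trans ih
      intro ω hω
      obtain ⟨U, S, ⟨hd, -⟩, hS⟩ := Set.mem_iUnion.mp hω
      refine ⟨fun j => if h : j ∈ I then S ⟨j, h⟩ else ∅, ?_, ?_⟩
      · intro j hj l hl hjl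
        simp only [hj, hl, dif_pos]
        exact hd _ _ fun h => hjl (congrArg Subtype.val h)
      · intro j hj
        simp only [hj, dif_pos]
        exact hS ⟨j, hj⟩

/-! ### Measurable substitutes for witness events -/

open Classical in
/-- The set of `ω` for which almost every configuration agreeing with `ω` on `S` lies in `A`: a
measurable substitute for the set of `ω` at which `S` witnesses `A`. -/
def essWitness (A : Set (∀ i, Ω i)) (S : Finset ι) : Set (∀ i, Ω i) :=
  {ω | Measure.pi μ {ω' | (fun i => if i ∈ S then ω i else ω' i) ∉ A} = 0}

open Classical in
lemma measurable_splice (S : Finset ι) :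
    Measurable fun p : (∀ i, Ω i) × (∀ i, Ω i) => fun i => if i ∈ S then p.1 i else p.2 i := by
  refine measurable_pi_lambda _ fun i => ?_
  by_cases h : i ∈ S <;> simp only [h, if_true, if_false] <;> fun_prop

open Classical in
lemma measurePreserving_splice (S : Finset ι) :
    MeasurePreserving (fun p : (∀ i, Ω i) × (∀ i, Ω i) => fun i => if i ∈ S then p.1 i else p.2 i)
      ((Measure.pi μ).prod (Measure.pi μ)) (Measure.pi μ) := by
  refine ⟨measurable_splice S, ?_⟩
  rw [← (measurePreserving_splitPairs μ fun _ => false).map_eq,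
    Measure.map_map (measurable_splice S) (measurable_splitPairs _)]
  have h := (measurePreserving_fst (μ := Measure.pi μ) (ν := Measure.pi μ)).comp
    (measurePreserving_splitPairs μ fun i => decide (i ∉ S))
  rw [← h.map_eq]
  congr 1
  ext w i
  by_cases hi : i ∈ S <;> simp [splitPairs, hi]

lemma measurableSet_essWitness {A : Set (∀ i, Ω i)} (hA : MeasurableSet A) (S : Finset ι) :
    MeasurableSet (essWitness μ A S) := by
  classical
  exact measurable_measure_prodMk_left (ν := Measure.pi μ) ((measurable_splice S) hA.compl)
    (measurableSet_singleton 0)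

lemma essWitness_congr (A : Set (∀ i, Ω i)) (S : Finset ι) (ω ω' : ∀ i, Ω i)
    (h : ∀ i ∈ S, ω' i = ω i) (hω : ω ∈ essWitness μ A S) : ω' ∈ essWitness μ A S := by
  classical
  have : ∀ x : ∀ i, Ω i, (fun i => if i ∈ S then ω' i else x i)
      = fun i => if i ∈ S then ω i else x i := by
    intro x; ext i
    by_cases hi : i ∈ S <;> simp [hi, h]
  simpa only [essWitness, Set.mem_ofPred_eq, this] using hω

lemma mem_essWitness_of_witnesses {A : Set (∀ i, Ω i)} {S : Finset ι} {ω : ∀ i, Ω i}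
    (h : Witnesses S ω A) : ω ∈ essWitness μ A S := by
  classical
  have : {ω' : ∀ i, Ω i | (fun i => if i ∈ S then ω i else ω' i) ∉ A} = ∅ := by
    ext ω'
    simpa using h _ fun i hi => by simp [hi]
  simp [essWitness, this]

/-- Resampling the coordinates off S preserves the law and membership in `essWitness`, while from
such a point it lands in A almost surely; Fubini concludes. -/
lemma measure_essWitness_diff {A : Set (∀ i, Ω i)} (hA : MeasurableSet A) (S : Finset ι) :
    Measure.pi μ (essWitness μ A S \ A) = 0 := by
  classical
  have hm := (measurableSet_essWitness μ hA S).diff hA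
  rw [← (measurePreserving_splice μ S).measure_preimage hm.nullMeasurableSet,
    Measure.measure_prod_null (measurable_splice S hm)]
  refine Filter.Eventually.of_forall fun ω => ?_
  by_cases hω : ω ∈ essWitness μ A S
  · exact measure_mono_null (fun ω' h => h.2) hω
  · refine measure_mono_null (fun ω' h => ?_) measure_empty
    exact hω (essWitness_congr μ A S _ _ (fun i hi => by simp [hi]) h.1)

lemma measure_iUnion_essWitness_le {A : Set (∀ i, Ω i)} (hA : MeasurableSet A) :
    Measure.pi μ (⋃ S, essWitness μ A S) ≤ Measure.pi μ A := by
  refine measure_mono_ae ?_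
  have : ∀ᵐ ω ∂Measure.pi μ, ∀ S, ω ∉ essWitness μ A S \ A :=
    ae_all_iff.mpr fun S => measure_eq_zero_iff_ae_notMem.mp (measure_essWitness_diff μ hA S)
  filter_upwards [this] with ω h hω
  obtain ⟨S, hS⟩ := Set.mem_iUnion.mp hω
  by_contra hn
  exact h S ⟨hS, hn⟩

end BKR

/-! ### Chernoff and Bernstein estimates -/

/-- Chernoff's bound for the size of a largest index set in a family of events whose
probabilities are dominated by products. -/
theorem measureReal_le_exp_chernoffPhi {X : Type*} [MeasurableSpace X] (P : Measure X)
    [IsProbabilityMeasure P] {κ : Type*} [Fintype κ] (E : Finset κ → Set X)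
    (hEm : ∀ I, MeasurableSet (E I)) (hanti : Antitone E) (p : κ → ℝ)
    (hEp : ∀ I, P.real (E I) ≤ ∏ j ∈ I, p j) (N : X → ℕ)
    (hN : ∀ x, ∃ I, x ∈ E I ∧ I.card = N x) {lam t : ℝ} (hlam : lam = ∑ j, p j)
    (hpos : 0 < lam) (ht : 0 ≤ t) :
    P.real {x | lam + t ≤ (N x : ℝ)} ≤ Real.exp (-(lam * chernoffPhi (t / lam))) := by
  classical
  set c := t / lam with hc
  have hc0 : 0 ≤ c := by positivity
  have hlogc : 0 ≤ Real.log (1 + c) := Real.log_nonneg (by linarith)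
  let F : X → ℝ := fun x => ∑ I : Finset κ, (E I).indicator (fun _ => c ^ I.card) x
  have hint : ∀ I, Integrable ((E I).indicator fun _ => c ^ I.card) P := fun I =>
    (integrable_const _).indicator (hEm I)
  have hF0 : 0 ≤ F := fun x => Finset.sum_nonneg fun I _ =>
    Set.indicator_nonneg (fun _ _ => by positivity) _
  have hFint : Integrable F P := integrable_finsetSum _ fun I _ => hint I
  have hpow : ∀ x, (1 + c) ^ N x ≤ F x := by
    intro x
    obtain ⟨I, hI, hcard⟩ := hN x
    have h1 : (1 + c) ^ N x = ∑ J ∈ I.powerset, c ^ J.card := by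
      rw [← hcard, ← Finset.prod_const, Finset.prod_one_add]
      simp
    have h2 : ∑ J ∈ I.powerset, c ^ J.card
        = ∑ J ∈ I.powerset, (E J).indicator (fun _ => c ^ J.card) x :=
      Finset.sum_congr rfl fun J hJ =>
        by
        rw [Set.indicator_of_mem (hanti (Finset.mem_powerset.mp hJ) hI)]
    rw [h1, h2]
    exact Finset.sum_le_univ_sum_of_nonneg fun J =>
      Set.indicator_nonneg (fun _ _ => by positivity) _
  -- N need not be measurable; Markov's inequality is applied to the integrable majorant F.
  have hsub : {x | lam + t ≤ (N x : ℝ)}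
      ⊆ {x | Real.exp ((lam + t) * Real.log (1 + c)) ≤ F x} := by
    intro x hx
    refine le_trans ?_ (hpow x)
    have h1 : (1 + c) ^ N x = Real.exp (N x * Real.log (1 + c)) := by
      rw [Real.exp_nat_mul, Real.exp_log (by linarith)]
    rw [h1]
    exact Real.exp_le_exp.mpr (mul_le_mul_of_nonneg_right hx hlogc)
  have hEF : ∫ x, F x ∂P ≤ Real.exp (c * lam) := by
    have h1 : ∫ x, F x ∂P = ∑ I : Finset κ, P.real (E I) * c ^ I.card := by
      simp only [F]
      rw [integral_finsetSum _ fun I _ => hint I]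
      exact Finset.sum_congr rfl fun I _ => by
        rw [integral_indicator_const _ (hEm I), smul_eq_mul]
    have hp0 : ∀ j, 0 ≤ p j := fun j => by
      simpa using measureReal_nonneg.trans (hEp {j})
    calc ∫ x, F x ∂P = ∑ I : Finset κ, P.real (E I) * c ^ I.card := h1
      _ ≤ ∑ I : Finset κ, ∏ j ∈ I, c * p j := by
        refine Finset.sum_le_sum fun I _ => ?_
        rw [Finset.prod_mul_distrib, Finset.prod_const, mul_comm]
        exact mul_le_mul_of_nonneg_left (hEp I) (by positivity)
      _ = ∏ j, (1 + c * p j) := by rw [Finset.prod_one_add]; simp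
      _ ≤ ∏ j, Real.exp (c * p j) := by
        refine Finset.prod_le_prod (fun j _ => ?_) fun j _ => ?_
        · have := mul_nonneg hc0 (hp0 j); linarith
        · linarith [Real.add_one_le_exp (c * p j)]
      _ = Real.exp (c * lam) := by rw [← Real.exp_sum, hlam, Finset.mul_sum]
  have hmarkov := mul_meas_ge_le_integral_of_nonneg (Filter.Eventually.of_forall hF0) hFint
    (Real.exp ((lam + t) * Real.log (1 + c)))
  have hle := (mul_le_mul_of_nonneg_left (measureReal_mono (μ := P) hsub)
    (Real.exp_pos _).le).trans (hmarkov.trans hEF)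
  rw [mul_comm, ← le_div_iff₀ (Real.exp_pos _), ← Real.exp_sub] at hle
  refine hle.trans (Real.exp_le_exp.mpr (le_of_eq ?_))
  rw [chernoffPhi]
  have : lam * c = t := by rw [hc]; field_simp
  linear_combination (Real.log (1 + c)) * this

/-- Bernstein's lower bound `x² / (2 (1 + x / 3)) ≤ φ x` for `x ≥ 0`. -/
lemma sq_div_le_chernoffPhi {x : ℝ} (hx : 0 ≤ x) : x ^ 2 / (2 * (1 + x / 3)) ≤ chernoffPhi x := by
  -- h = f', both vanish at 0, and h' ≥ 0 because (3 + y)³ ≥ 27(1 + y).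
  let h : ℝ → ℝ := fun y => Real.log (1 + y) - (3 / 2 - 27 / (2 * (3 + y) ^ 2))
  let f : ℝ → ℝ := fun y => chernoffPhi y - y ^ 2 / (2 * (1 + y / 3))
  have hh : ∀ y, 0 ≤ y → HasDerivAt h (1 / (1 + y) - 27 / (3 + y) ^ 3) y := by
    intro y hy
    have h1 : HasDerivAt (fun y : ℝ => 1 + y) 1 y := (hasDerivAt_id y).const_add 1
    have h3 : HasDerivAt (fun y : ℝ => 2 * (3 + y) ^ 2) (2 * (2 * (3 + y))) y := by
      simpa using ((((hasDerivAt_id y).const_add 3).pow 2).const_mul 2)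
    have h4 := ((hasDerivAt_const y (27 : ℝ)).div h3 (by positivity)).const_sub (3 / 2)
    have := (h1.log (by positivity)).sub h4
    refine this.congr_deriv ?_
    field_simp
    ring
  have hf : ∀ y, 0 ≤ y → HasDerivAt f (h y) y := by
    intro y hy
    have h1 : HasDerivAt (fun y : ℝ => 1 + y) 1 y := (hasDerivAt_id y).const_add 1
    have h2 := (h1.mul (h1.log (by positivity))).sub (hasDerivAt_id y)
    have h3 : HasDerivAt (fun y : ℝ => 2 * (1 + y / 3)) (2 * (1 / 3)) y :=
      (((hasDerivAt_id y).div_const 3).const_add 1).const_mul 2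
    have h4 := (((hasDerivAt_id y).pow 2)).div h3 (by simp; positivity)
    have := h2.sub h4
    refine this.congr_deriv ?_
    simp only [h, id, Pi.pow_apply]
    field_simp
    ring
  have mono : ∀ (F F' : ℝ → ℝ), (∀ y, 0 ≤ y → HasDerivAt F (F' y) y) → (∀ y, 0 ≤ y → 0 ≤ F' y) →
      ∀ y, 0 ≤ y → F 0 ≤ F y := by
    intro F F' hF hF' y hy
    refine monotoneOn_of_deriv_nonneg (convex_Ici 0)
      (fun z hz => (hF z hz).continuousAt.continuousWithinAt)
      (fun z hz => ?_) (fun z hz => ?_) Set.self_mem_Ici hy hy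
    · rw [interior_Ici] at hz
      exact (hF z hz.le).differentiableAt.differentiableWithinAt
    · rw [interior_Ici] at hz
      rw [(hF z hz.le).deriv]
      exact hF' z hz.le
  have hh0 : ∀ y, 0 ≤ y → 0 ≤ h y := by
    intro y hy
    refine le_trans (le_of_eq ?_) (mono h _ hh (fun z hz => ?_) y hy)
    · norm_num [h]
    · rw [sub_nonneg, div_le_div_iff₀ (by positivity) (by positivity)]
      nlinarith [pow_nonneg hz 2, pow_nonneg hz 3]
  have := mono f h hf hh0 x hx
  have h0 : f 0 = 0 := by simp [f, chernoffPhi]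
  simp only [h0, f] at this
  linarith

/-! ### The tail bound for X -/

lemma exists_card_eq_maxDisjoint {ι κ : Type*} [Fintype κ] {Ω : ι → Type*}
    (A : κ → Set (∀ i, Ω i)) (ω : ∀ i, Ω i) :
    ∃ I, ω ∈ disjointOccurrence A I ∧ I.card = maxDisjoint A ω := by
  classical
  obtain ⟨I, hI, h⟩ := Finset.exists_mem_eq_sup
    (Finset.univ.filter fun I : Finset κ => ω ∈ disjointOccurrence A I)
    ⟨∅, Finset.mem_filter.mpr ⟨Finset.mem_univ _, by simp [disjointOccurrence]⟩⟩ Finset.card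
  exact ⟨I, by simpa using hI, by rw [maxDisjoint, ← h]⟩

theorem theorem2 {n k : ℕ} {Ω : Fin n → Type*}
    [∀ i, LinearOrder (Ω i)] [∀ i, MeasurableSpace (Ω i)]
    (μ : ∀ i, Measure (Ω i)) [∀ i, IsProbabilityMeasure (μ i)]
    (A : Fin k → Set (∀ i, Ω i)) (hA : ∀ j, MeasurableSet (A j))
    (lam : ℝ) (hlam : lam = ∑ j, (Measure.pi μ).real (A j))
    (t : ℝ) (ht : 0 ≤ t) :
    (0 < lam →
      (Measure.pi μ).real {ω | lam + t ≤ (maxDisjoint A ω : ℝ)}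
          ≤ Real.exp (-(lam * chernoffPhi (t / lam))) ∧
      Real.exp (-(lam * chernoffPhi (t / lam)))
          ≤ Real.exp (-(t ^ 2 / (2 * (lam + t / 3))))) ∧
    (lam = 0 → 0 < t →
      (Measure.pi μ).real {ω | lam + t ≤ (maxDisjoint A ω : ℝ)} = 0) := by
  refine ⟨fun hpos => ⟨?_, ?_⟩, fun h0 htpos => ?_⟩
  · let E : Finset (Fin k) → Set (∀ i, Ω i) := fun I =>
      {ω | ∃ S : Fin k → Finset (Fin n), (∀ j ∈ I, ∀ l ∈ I, j ≠ l → Disjoint (S j) (S l)) ∧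
        ∀ j ∈ I, ω ∈ essWitness μ (A j) (S j)}
    refine measureReal_le_exp_chernoffPhi (Measure.pi μ) E (fun I => ?_) ?_
      (fun j => (Measure.pi μ).real (A j)) (fun I => ?_) (maxDisjoint A) (fun ω => ?_) hlam hpos ht
    · have : E I = ⋃ S : Fin k → Finset (Fin n),
          ⋃ _ : ∀ j ∈ I, ∀ l ∈ I, j ≠ l → Disjoint (S j) (S l),
            ⋂ j ∈ I, essWitness μ (A j) (S j) := by ext; simp [E]
      rw [this]
      exact .iUnion fun S => .iUnion fun _ => .biInter (Set.to_countable _) fun j _ =>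
        measurableSet_essWitness μ (hA j) (S j)
    · rintro I J hIJ ω ⟨S, hd, hS⟩
      exact ⟨S, fun j hj l hl => hd j (hIJ hj) l (hIJ hl), fun j hj => hS j (hIJ hj)⟩
    · simp only [measureReal_def, ← ENNReal.toReal_prod]
      refine ENNReal.toReal_mono (ENNReal.prod_ne_top fun _ _ => measure_ne_top _ _) ?_
      exact (measure_disjoint_occurrence_le_prod μ
        (fun j S => measurableSet_essWitness μ (hA j) S)
        (fun j S => essWitness_congr μ (A j) S) I).trans
        (Finset.prod_le_prod' fun j _ => measure_iUnion_essWitness_le μ (hA j))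
    · obtain ⟨I, ⟨S, hd, hS⟩, hI⟩ := exists_card_eq_maxDisjoint A ω
      exact ⟨I, ⟨S, hd, fun j hj => mem_essWitness_of_witnesses μ (hS j hj)⟩, hI⟩
  · refine Real.exp_le_exp.mpr (neg_le_neg ?_)
    have h := mul_le_mul_of_nonneg_left (sq_div_le_chernoffPhi (x := t / lam) (by positivity))
      hpos.le
    refine le_trans (le_of_eq ?_) h
    field_simp
  · have hA0 : ∀ j, Measure.pi μ (A j) = 0 := by
      intro j
      have := (Finset.sum_eq_zero_iff_of_nonneg fun j _ => measureReal_nonneg).mp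
        (hlam.symm.trans h0) j (Finset.mem_univ j)
      exact (measureReal_eq_zero_iff).mp this
    rw [measureReal_eq_zero_iff]
    -- X > 0 forces ω into some A j, and all of these are null.
    refine measure_mono_null (fun ω hω => ?_) (measure_iUnion_null hA0)
    obtain ⟨I, ⟨S, -, hS⟩, hI⟩ := exists_card_eq_maxDisjoint A ω
    have hω' : lam + t ≤ (maxDisjoint A ω : ℝ) := hω
    have hne : I.Nonempty := by
      rw [← Finset.card_pos, hI]
      exact_mod_cast (by linarith : (0 : ℝ) < maxDisjoint A ω)
    obtain ⟨j, hj⟩ := hne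
    exact Set.mem_iUnion.mpr ⟨j, hS j hj ω fun _ _ => rfl⟩
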